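/- An \emph{interior residuated lattice-ordered unital groupoid} (interior $r\ell u$-groupoid) is an algebra $\mathbf A=(A,\wedge,\vee,\cdot,\backslash,/,!,1)$ such that $(A,\wedge,\vee)$ is a lattice, $(A,\cdot,1)$ is a (not necessarily associative) groupoid with two-sided unit $1$, for all $x,y,z\in A$ one has $x\cdot y\le z \iff y\le x\backslash z \iff x\le z/y$, and the unary operation $!$ satisfies, for all $x,y\in A$: $1\le\, !1$, $\;!x\cdot !y\le\, !(x\cdot y)$, $\;!x\le x$, $\;!x\le\, !!x$, and $x\le y$ implies $!x\le\, !y$. It is \emph{integral} if $x\le 1$ for all $x\in A$. Consider the (in)equations \[ \begin{aligned} &(\mathsf e)\ x\cdot y\le y\cdot x, &\quad &(\mathsf c)\ x\le x\cdot x,\\ &(!\mathsf e)\ !x\cdot y=y\cdot !x, &&(!\mathsf c)\ !x\le\, !x\cdot !x,\\ &(!\mathsf{a1})\ !x\cdot(y\cdot z)=(!x\cdot y)\cdot z, &&(!\mathsf{a2})\ x\cdot(y\cdot !z)=(x\cdot y)\cdot !z. \end{aligned} \] For a subset $B\subseteq A$, the \emph{partial subalgebra} $\mathbf B$ of $\mathbf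 A$ on $B$ is the partial algebra with universe $B$ in which, for each fundamental operation $f$ and each tuple $\bar x$ from $B$, $f^{\mathbf B}(\bar x)=f^{\mathbf A}(\bar x)$ if $f^{\mathbf A}(\bar x)\in B$, and $f^{\mathbf B}(\bar x)$ is undefined otherwise. An \emph{embedding} of a partial algebra $\mathbf B$ into an algebra $\mathbf C$ of the same language is an injective map $\varphi$ with $\varphi(f^{\mathbf B}(\bar x))=f^{\mathbf C}(\varphi(\bar x))$ whenever $f^{\mathbf B}(\bar x)$ is defined. A class $\mathcal K$ of algebras has the \emph{finite embeddability property} if every finite partial subalgebra of a member of $\mathcal K$ embeds into a finite member of $\mathcal K$. \textbf{Corollary.} Let $R\subseteq\{(\mathsf e),(\mathsf c),(!\mathsf e),(!\mathsf c),(!\mathsf{a1}),(!\mathsf{a2})\}$ be any subset (possibly empty), and let $\mathcal V$ be the variety of all integral interior $r\ell u$-groupoids satisfying every (in)equation in $R$. Then $\mathcal V$ has the finite embeddability property. -/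

import Mathlib

universe u v

namespace RLU


/-! ## Universal algebra: partial algebras, partial subalgebras, the FEP

Algebraic languages are Mathlib's first-order languages without relation symbols, and an algebra
for such a language is a structure for it. -/

/-- A partial algebra: every function symbol is interpreted by a partial operation. -/
structure PartialAlgebra (L : FirstOrder.Language.{0, 0}) where
  carrier : Type u
  op : ∀ {n : ℕ}, L.Functions n → (Fin n → carrier) →. carrier

/-- The partial subalgebra of the algebra `A` on the subset `B`: the operation `f` is defined at
`x` exactly when its value in `A` lies in `B`, and then it has this value. -/
def partialSubalgebra {L : FirstOrder.Language.{0, 0}} (A : Type u) [L.Structure A] (B : Set A) :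
    PartialAlgebra.{u} L where
  carrier := B
  op f x :=
    { Dom := FirstOrder.Language.Structure.funMap f (fun i => (x i : A)) ∈ B
      get := fun h => ⟨FirstOrder.Language.Structure.funMap f (fun i => (x i : A)), h⟩ }

/-- `φ` is an embedding of the partial algebra `P` into the algebra `C`: it is injective and
preserves every operation wherever that operation is defined in `P`. -/
structure IsEmbedding {L : FirstOrder.Language.{0, 0}} (P : PartialAlgebra.{u} L)
    (C : Type v) [L.Structure C] (φ : P.carrier → C) : Prop where
  injective : Function.Injective φ
  map_op : ∀ {n : ℕ} (f : L.Functions n) (x : Fin n → P.carrier) (h : (P.op f x).Dom),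
    φ ((P.op f x).get h) = FirstOrder.Language.Structure.funMap f (fun i => φ (x i))

/-- The finite embeddability property of a class `K` of algebras: every finite partial subalgebra
of a member of `K` is embedded into a finite member of `K`. -/
def HasFEP {L : FirstOrder.Language.{0, 0}} [L.IsAlgebraic]
    (K : Set (CategoryTheory.Bundled.{u} L.Structure)) : Prop :=
  ∀ A ∈ K, ∀ B : Set A, B.Finite →
    ∃ C ∈ K, Finite C ∧ ∃ φ : (partialSubalgebra (L := L) A B).carrier → C,
      IsEmbedding (partialSubalgebra (L := L) A B) C φ

/-! ## Interior residuated lattice-ordered unital groupoids -/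

/-- A residuated lattice-ordered unital groupoid; `ldiv x z` is `x \ z` and `rdiv z y` is
`z / y`. -/
class RLUGroupoid (A : Type u) extends Lattice A, MulOneClass A where
  ldiv : A → A → A
  rdiv : A → A → A
  mul_le_iff_le_ldiv : ∀ x y z : A, x * y ≤ z ↔ y ≤ ldiv x z
  mul_le_iff_le_rdiv : ∀ x y z : A, x * y ≤ z ↔ x ≤ rdiv z y

/-- An interior residuated lattice-ordered unital groupoid; `bang x` is `!x`. -/
class InteriorRLUGroupoid (A : Type u) extends RLUGroupoid A where
  bang : A → A
  one_le_bang_one : (1 : A) ≤ bang 1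
  bang_mul_bang_le : ∀ x y : A, bang x * bang y ≤ bang (x * y)
  bang_le : ∀ x : A, bang x ≤ x
  bang_le_bang_bang : ∀ x : A, bang x ≤ bang (bang x)
  bang_mono : ∀ x y : A, x ≤ y → bang x ≤ bang y

/-- The operation symbols `∧, ∨, ·, \, /, !, 1` with their arities. -/
inductive OpSymbol : ℕ → Type
  | inf : OpSymbol 2
  | sup : OpSymbol 2
  | mul : OpSymbol 2
  | ldiv : OpSymbol 2
  | rdiv : OpSymbol 2
  | bang : OpSymbol 1
  | one : OpSymbol 0

/-- The language of interior residuated lattice-ordered unital groupoids. -/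
def lang : FirstOrder.Language.{0, 0} := ⟨OpSymbol, fun _ => Empty⟩

instance : lang.IsAlgebraic := fun _ => inferInstanceAs (IsEmpty Empty)

/-- The interpretation of the operation symbols in an interior residuated lattice-ordered unital
groupoid. -/
def interp (A : Type u) [InteriorRLUGroupoid A] : ∀ {n : ℕ}, OpSymbol n → (Fin n → A) → A
  | _, .inf, x => x 0 ⊓ x 1
  | _, .sup, x => x 0 ⊔ x 1
  | _, .mul, x => x 0 * x 1
  | _, .ldiv, x => RLUGroupoid.ldiv (x 0) (x 1)
  | _, .rdiv, x => RLUGroupoid.rdiv (x 0) (x 1)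
  | _, .bang, x => InteriorRLUGroupoid.bang (x 0)
  | _, .one, _ => 1

/-- An interior residuated lattice-ordered unital groupoid as an algebra in the sense of universal
algebra. -/
@[reducible]
def toAlgebra (A : Type u) [InteriorRLUGroupoid A] : lang.Structure A where
  funMap f x := interp A f x
  RelMap r _ := nomatch r

/-- Integrality, the (in)equation (i). -/
def Integral (A : Type u) [InteriorRLUGroupoid A] : Prop := ∀ x : A, x ≤ 1

/-- Names of the (in)equations (e), (c), (!e), (!c), (!a1), (!a2). -/
inductive Eqn
  | e | c | bang_e | bang_c | bang_a1 | bang_a2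

open InteriorRLUGroupoid (bang) in
/-- The (in)equation holds in `A`. -/
def Eqn.Holds (A : Type u) [InteriorRLUGroupoid A] : Eqn → Prop
  | .e => ∀ x y : A, x * y ≤ y * x
  | .c => ∀ x : A, x ≤ x * x
  | .bang_e => ∀ x y : A, bang x * y = y * bang x
  | .bang_c => ∀ x : A, bang x ≤ bang x * bang x
  | .bang_a1 => ∀ x y z : A, bang x * (y * z) = (bang x * y) * z
  | .bang_a2 => ∀ x y z : A, x * (y * bang z) = (x * y) * bang z

/-- The variety of all integral interior residuated lattice-ordered unital groupoids that satisfy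
every (in)equation in `R`. -/
def variety (R : Set Eqn) : Set (CategoryTheory.Bundled.{u} lang.Structure) :=
  {A | ∃ inst : InteriorRLUGroupoid A,
    A.str = @toAlgebra A inst ∧ @Integral A inst ∧ ∀ q ∈ R, @Eqn.Holds A inst q}

end RLU

/-! Let W be the unital subgroupoid generated by B. The finite algebra consists of the subsets of W
cut out by bounds, where a bound arises from a member of B by repeated division by members of W.
Closing the bounds under division makes the closure operator compatible with multiplication
(`ofObjects_extent_mul_extent`), so the closed sets are residuated. The (in)equations pass from W to
closed sets (`holds`), and b ↦ {w | w ≤ b} is the embedding (`isEmbedding_principal`).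

Finiteness comes from Kruskal's theorem. Members of W are values of trees with leaves in B ∪ {1}. By
integrality, deleting factors can only increase the value, so the trees with value below a given
bound form an up-set for homeomorphic embedding, which has finitely many minimal trees. Division by
w does not lengthen the generating trees (`exists_upSet_mul_left`, `exists_upSet_mul_right`), so one
length bound serves all bounds, and only finitely many sets {w | w ≤ z} occur
(`finite_galoisAlgebra`). -/

/-! ## Homeomorphic embedding of binary trees -/

namespace FreeMagma

variable {α : Type*}

/-- Homeomorphic embedding of binary trees with labelled leaves. -/
inductive Embeds : FreeMagma α → FreeMagma α → Prop
  | of (a : α) : Embeds (of a) (of a)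
  | left {s l : FreeMagma α} (r : FreeMagma α) : Embeds s l → Embeds s (l * r)
  | right {s r : FreeMagma α} (l : FreeMagma α) : Embeds s r → Embeds s (l * r)
  | mul {l r l' r' : FreeMagma α} : Embeds l l' → Embeds r r' → Embeds (l * r) (l' * r')

namespace Embeds

theorem refl (t : FreeMagma α) : Embeds t t := by
  induction t with
  | ih1 a => exact .of a
  | ih2 l r hl hr => exact .mul hl hr

theorem mul_right_iff {s x y : FreeMagma α} :
    Embeds s (x * y) ↔
      Embeds s x ∨ Embeds s y ∨ ∃ l r, s = l * r ∧ Embeds l x ∧ Embeds r y := by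
  constructor
  · intro h
    cases h with
    | left _ h => exact .inl h
    | right _ h => exact .inr (.inl h)
    | mul hl hr => exact .inr (.inr ⟨_, _, rfl, hl, hr⟩)
  · rintro (h | h | ⟨l, r, rfl, hl, hr⟩)
    exacts [.left _ h, .right _ h, .mul hl hr]

theorem trans {s t u : FreeMagma α} (hst : Embeds s t) (htu : Embeds t u) : Embeds s u := by
  induction htu generalizing s with
  | of a => exact hst
  | left r _ ih => exact .left r (ih hst)
  | right l _ ih => exact .right l (ih hst)
  | mul _ _ ihl ihr =>
    rcases mul_right_iff.1 hst with h | h | ⟨l, r, rfl, hl, hr⟩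
    exacts [.left _ (ihl h), .right _ (ihr h), .mul (ihl hl) (ihr hr)]

instance : IsPreorder (FreeMagma α) Embeds where
  refl := refl
  trans _ _ _ := trans

theorem length_le {s t : FreeMagma α} (h : Embeds s t) : s.length ≤ t.length := by
  induction h with
  | of a => rfl
  | left r _ ih => exact ih.trans (Nat.le_add_right _ _)
  | right l _ ih => exact ih.trans (Nat.le_add_left _ _)
  | mul _ _ ihl ihr => exact Nat.add_le_add ihl ihr

theorem eq_of_length_le {s t : FreeMagma α} (h : Embeds s t) (hl : t.length ≤ s.length) :
    s = t := by
  induction h with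
  | of a => rfl
  | @left s l r h _ =>
    have h1 := h.length_le
    have h2 := r.length_pos
    have h3 : (l * r).length = l.length + r.length := rfl
    omega
  | @right s r l h _ =>
    have h1 := h.length_le
    have h2 := l.length_pos
    have h3 : (l * r).length = l.length + r.length := rfl
    omega
  | @mul l r l' r' h h' ih ih' =>
    have h1 := h.length_le
    have h2 := h'.length_le
    have h3 : (l * r).length = l.length + r.length := rfl
    have h4 : (l' * r').length = l'.length + r'.length := rfl
    rw [ih (by omega), ih' (by omega)]

open Set PartiallyWellOrderedOn in
/-- Kruskal's theorem for binary trees whose leaves have finitely many labels. -/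
theorem wellQuasiOrdered [Finite α] : WellQuasiOrdered (Embeds (α := α)) := by
  rw [← partiallyWellOrderedOn_univ_iff, iff_not_exists_isMinBadSeq FreeMagma.length]
  rintro ⟨f, hf, hmin⟩
  set S : Set (FreeMagma α) := {s | ∃ n, Embeds s (f n) ∧ s.length < (f n).length} with hS
  have hSpwo : S.PartiallyWellOrderedOn Embeds := by
    rw [partiallyWellOrderedOn_iff_exists_lt]
    intro g hg
    choose k hk hlt using hg
    obtain ⟨p, hp⟩ : ∃ p, ∀ q, k p ≤ k q :=
      ⟨Function.argmin k, fun q => Function.argmin_le k q⟩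
    -- Nash-Williams: follow `f` up to index `k p`, then `g` from `p` on. Minimality of `f` yields a
    -- good pair in this sequence, and as `k p` is least, the pair must lie within `g`.
    have hbad := hmin (k p) (fun n => if n < k p then f n else g (p + (n - k p)))
      (fun m hm => (if_pos hm).symm) (by simpa using hlt p)
    have : ∃ m n, m < n ∧ Embeds (if m < k p then f m else g (p + (m - k p)))
        (if n < k p then f n else g (p + (n - k p))) := by
      by_contra! hcon
      exact hbad ⟨fun _ => mem_univ _, hcon⟩
    obtain ⟨m, n, hmn, h⟩ := this
    split_ifs at h with h1 h2 h2
    · exact absurd h (hf.2 m n hmn)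
    · exact absurd (h.trans (hk _)) (hf.2 _ _ (h1.trans_le (hp _)))
    · omega
    · exact ⟨_, _, by omega, h⟩
  have hprod := (hSpwo.prod hSpwo).image_of_monotone_on (r' := Embeds)
    (f := fun p : FreeMagma α × FreeMagma α => p.1 * p.2) fun _ _ _ _ h => .mul h.1 h.2
  have hleaf := (finite_range (FreeMagma.of : α → FreeMagma α)).partiallyWellOrderedOn
    (r := Embeds)
  -- Each `f n` is a leaf or a product of two trees in `S`, so `f` cannot be bad.
  obtain ⟨m, n, hmn, h⟩ := (hprod.union hleaf).exists_lt (f := f) fun n => by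
    cases hn : f n with
    | of a => exact .inr ⟨a, rfl⟩
    | mul l r =>
      have h1 := l.length_pos
      have h2 := r.length_pos
      have h3 : (f n).length = l.length + r.length := by rw [hn]; rfl
      refine .inl ⟨(l, r), ⟨⟨n, ?_, by simp only; omega⟩, ⟨n, ?_, by simp only; omega⟩⟩, rfl⟩
      · rw [hn]; exact .left _ (refl l)
      · rw [hn]; exact .right _ (refl r)
  exact hf.2 m n hmn h

end Embeds

/-! ### Up-sets of trees and their generators -/

/-- The set of trees in which some member of `G` embeds. -/
def upSet (G : Set (FreeMagma α)) : Set (FreeMagma α) := {t | ∃ s ∈ G, Embeds s t}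

theorem upSet_range_of : upSet (Set.range (of : α → FreeMagma α)) = Set.univ := by
  refine Set.eq_univ_of_forall fun t => ?_
  induction t with
  | ih1 a => exact ⟨_, ⟨a, rfl⟩, .of a⟩
  | ih2 l r hl _ =>
    obtain ⟨s, hs, h⟩ := hl
    exact ⟨s, hs, .left r h⟩

/-- The minimal trees generate, by induction on length, and form an antichain, which is finite by
Kruskal's theorem. -/
theorem exists_finite_upSet_eq [Finite α] {U : Set (FreeMagma α)}
    (hU : ∀ s ∈ U, ∀ t, Embeds s t → t ∈ U) : ∃ G : Set (FreeMagma α), G.Finite ∧ upSet G = U := by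
  refine ⟨{t ∈ U | ∀ s ∈ U, Embeds s t → s = t}, ?_, ?_⟩
  · refine IsAntichain.finite_of_wellQuasiOrdered (r := Embeds) ?_ Embeds.wellQuasiOrdered
    exact fun s hs t ht hne h => hne (ht.2 s hs.1 h)
  · refine Set.Subset.antisymm (fun t ⟨s, hs, h⟩ => hU s hs.1 t h) fun t ht => ?_
    induction hn : t.length using Nat.strong_induction_on generalizing t with
    | _ n ih =>
      by_cases h : ∀ s ∈ U, Embeds s t → s = t
      · exact ⟨t, ⟨ht, h⟩, .refl t⟩
      · push Not at h
        obtain ⟨s, hs, hst, hne⟩ := h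
        have hlt : s.length < n := by
          by_contra hcon
          exact hne (hst.eq_of_length_le (by omega))
        obtain ⟨g, hg, hgs⟩ := ih _ hlt s hs rfl
        exact ⟨g, hg, hgs.trans hst⟩

theorem finite_length_le [Finite α] (n : ℕ) : {t : FreeMagma α | t.length ≤ n}.Finite := by
  induction n with
  | zero =>
    refine Set.finite_empty.subset fun t ht => ?_
    have h1 : t.length ≤ 0 := ht
    have h2 := t.length_pos
    omega
  | succ n ih =>
    refine ((Set.finite_range of).union (Set.Finite.image2 (· * ·) ih ih)).subset fun t ht => ?_
    cases t with
    | of a => exact .inl ⟨a, rfl⟩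
    | mul l r =>
      have h1 : l.length + r.length ≤ n + 1 := ht
      have h2 := l.length_pos
      have h3 := r.length_pos
      exact .inr ⟨l, by simp only [Set.mem_ofPred_eq]; omega, r,
        by simp only [Set.mem_ofPred_eq]; omega, rfl⟩

/-- If `w` is already in the up-set, every tree qualifies and the leaves generate, whence `1 ≤ n`.
Otherwise a generator embeds in `w * t` either inside `t` or by splitting at the root, so adding
right factors of generators suffices. -/
theorem exists_upSet_mul_left {n : ℕ} (hn : 1 ≤ n) {G : Set (FreeMagma α)}
    (hG : ∀ s ∈ G, s.length ≤ n) (w : FreeMagma α) :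
    ∃ G' : Set (FreeMagma α), (∀ s ∈ G', s.length ≤ n) ∧ {t | w * t ∈ upSet G} = upSet G' := by
  by_cases hw : w ∈ upSet G
  · refine ⟨Set.range of, ?_, ?_⟩
    · rintro _ ⟨a, rfl⟩
      exact hn
    · rw [upSet_range_of]
      obtain ⟨s, hs, h⟩ := hw
      exact Set.eq_univ_of_forall fun t => ⟨s, hs, .left t h⟩
  · refine ⟨G ∪ {r | ∃ l, l * r ∈ G ∧ Embeds l w}, ?_, ?_⟩
    · rintro s (hs | ⟨l, hs, -⟩)
      · exact hG s hs
      · exact (Nat.le_add_left _ _).trans (hG _ hs)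
    · ext t
      constructor
      · rintro ⟨s, hs, h⟩
        rcases Embeds.mul_right_iff.1 h with h | h | ⟨l, r, rfl, hl, hr⟩
        · exact absurd ⟨s, hs, h⟩ hw
        · exact ⟨s, .inl hs, h⟩
        · exact ⟨r, .inr ⟨l, hs, hl⟩, hr⟩
      · rintro ⟨s, hs | ⟨l, hs, hl⟩, h⟩
        · exact ⟨s, hs, .right w h⟩
        · exact ⟨_, hs, .mul hl h⟩

theorem exists_upSet_mul_right {n : ℕ} (hn : 1 ≤ n) {G : Set (FreeMagma α)}
    (hG : ∀ s ∈ G, s.length ≤ n) (w : FreeMagma α) :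
    ∃ G' : Set (FreeMagma α), (∀ s ∈ G', s.length ≤ n) ∧ {t | t * w ∈ upSet G} = upSet G' := by
  by_cases hw : w ∈ upSet G
  · refine ⟨Set.range of, ?_, ?_⟩
    · rintro _ ⟨a, rfl⟩
      exact hn
    · rw [upSet_range_of]
      obtain ⟨s, hs, h⟩ := hw
      exact Set.eq_univ_of_forall fun t => ⟨s, hs, .right t h⟩
  · refine ⟨G ∪ {l | ∃ r, l * r ∈ G ∧ Embeds r w}, ?_, ?_⟩
    · rintro s (hs | ⟨r, hs, -⟩)
      · exact hG s hs
      · exact (Nat.le_add_right _ _).trans (hG _ hs)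
    · ext t
      constructor
      · rintro ⟨s, hs, h⟩
        rcases Embeds.mul_right_iff.1 h with h | h | ⟨l, r, rfl, hl, hr⟩
        · exact ⟨s, .inl hs, h⟩
        · exact absurd ⟨s, hs, h⟩ hw
        · exact ⟨l, .inr ⟨r, hs, hr⟩, hl⟩
      · rintro ⟨s, hs | ⟨r, hs, hr⟩, h⟩
        · exact ⟨s, hs, .left w h⟩
        · exact ⟨_, hs, .mul h hr⟩

end FreeMagma

/-! ### Finiteness of concept lattices -/

/-- A concept lattice is finite if its attributes have only finitely many lower polars. -/
theorem Concept.finite_of_finite_lowerPolar {α β : Type*} {r : α → β → Prop}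
    (h : (Set.range fun b => {a | r a b}).Finite) : Finite (Concept α β r) := by
  -- An extent is the intersection of the lower polars of the attributes in the intent.
  have hinj : Function.Injective fun c : Concept α β r => (fun b => {a | r a b}) '' c.intent := by
    intro c d hcd
    have hext : ∀ e : Concept α β r,
        e.extent = ⋂₀ ((fun b => {a | r a b}) '' e.intent) := fun e => by
      ext a
      have ha : a ∈ e.extent ↔ a ∈ lowerPolar r e.intent := by rw [e.lowerPolar_intent]
      rw [ha, mem_lowerPolar_iff]
      simp
    exact Concept.ext (by rw [hext c, hext d]; exact congrArg _ hcd)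
  have : Finite {S // S ⊆ Set.range fun b => {a | r a b}} := h.finite_subsets
  exact Finite.of_injective (fun c => ⟨_, Set.image_subset_range _ c.intent⟩ :
    Concept α β r → {S // S ⊆ Set.range fun b => {a | r a b}})
    fun c d hcd => hinj (congrArg Subtype.val hcd)

namespace RLU

open InteriorRLUGroupoid RLUGroupoid

section Order

variable {A : Type u} [RLUGroupoid A]

theorem mul_le_mul {a b c d : A} (hab : a ≤ b) (hcd : c ≤ d) : a * c ≤ b * d := by
  have h1 : b * c ≤ b * d :=
    (mul_le_iff_le_ldiv _ _ _).2 (hcd.trans ((mul_le_iff_le_ldiv _ _ _).1 le_rfl))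
  exact (mul_le_iff_le_rdiv _ _ _).2 (hab.trans ((mul_le_iff_le_rdiv _ _ _).1 h1))

end Order

section Interior

variable {A : Type u} [InteriorRLUGroupoid A]

theorem bang_one : bang (1 : A) = 1 := le_antisymm (bang_le 1) one_le_bang_one

theorem bang_bang (x : A) : bang (bang x) = bang x := le_antisymm (bang_le _) (bang_le_bang_bang x)

theorem bang_mul_of_fixed {x y : A} (hx : bang x = x) (hy : bang y = y) :
    bang (x * y) = x * y :=
  le_antisymm (bang_le _) (by simpa only [hx, hy] using bang_mul_bang_le x y)

/-- In an integral algebra, evaluation of trees reverses homeomorphic embedding. -/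
theorem lift_le_of_embeds (hi : Integral A) {α : Type*} (e : α → A) {s t : FreeMagma α}
    (h : FreeMagma.Embeds s t) : FreeMagma.lift e t ≤ FreeMagma.lift e s := by
  induction h with
  | of a => rfl
  | left r _ ih =>
    rw [map_mul]
    exact (mul_le_mul ih (hi _)).trans_eq (mul_one _)
  | right l _ ih =>
    rw [map_mul]
    exact (mul_le_mul (hi _) ih).trans_eq (one_mul _)
  | mul _ _ ihl ihr =>
    rw [map_mul, map_mul]
    exact mul_le_mul ihl ihr

/-! ### Bounds and finiteness of the Galois algebra -/

/-- The closure of `B` under division by members of the unital subgroupoid generated by `B`. -/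
inductive IsBound (B : Set A) : A → Prop
  | base {b : A} : b ∈ B → IsBound B b
  | ldiv {w z : A} : w ∈ Submonoid.closure B → IsBound B z → IsBound B (ldiv w z)
  | rdiv {w z : A} : w ∈ Submonoid.closure B → IsBound B z → IsBound B (rdiv z w)

/-- The order of `A` between the unital subgroupoid generated by `B` and the bounds. -/
def boundRel (B : Set A) (w : Submonoid.closure B) (z : {z : A // IsBound B z}) : Prop :=
  (w : A) ≤ z

/-- The Galois algebra of `B`. -/
abbrev GaloisAlgebra (B : Set A) : Type u :=
  Concept (Submonoid.closure B) {z : A // IsBound B z} (boundRel B)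

/-- The label 1 is adjoined because `FreeMagma` has no empty tree. -/
theorem exists_lift_eq {B : Set A} {w : A} (hw : w ∈ Submonoid.closure B) :
    ∃ t : FreeMagma ↥(insert 1 B), FreeMagma.lift Subtype.val t = w := by
  induction hw using Submonoid.closure_induction with
  | mem x hx => exact ⟨.of ⟨x, .inr hx⟩, rfl⟩
  | one => exact ⟨.of ⟨1, .inl rfl⟩, rfl⟩
  | mul x y _ _ hx hy =>
    obtain ⟨s, rfl⟩ := hx
    obtain ⟨t, rfl⟩ := hy
    exact ⟨s * t, map_mul _ _ _⟩

/-- Only the finitely many members of `B` need Kruskal's theorem; each division then preserves the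
length bound, so `n` is uniform in `z`. -/
theorem exists_upSet_of_isBound (hi : Integral A) {B : Set A} (hB : B.Finite) :
    ∃ n, ∀ z, IsBound B z → ∃ G : Set (FreeMagma ↥(insert 1 B)), (∀ s ∈ G, s.length ≤ n) ∧
      {t | FreeMagma.lift Subtype.val t ≤ z} = FreeMagma.upSet G := by
  have : Finite ↥(insert 1 B : Set A) := hB.insert 1
  choose G hG hGU using fun z : A => FreeMagma.exists_finite_upSet_eq
    (U := {t : FreeMagma ↥(insert 1 B) | FreeMagma.lift Subtype.val t ≤ z})
    fun s hs t h => (lift_le_of_embeds hi _ h).trans hs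
  obtain ⟨n, hn⟩ := ((hB.biUnion fun b _ => hG b).image FreeMagma.length).bddAbove
  refine ⟨max 1 n, fun z hz => ?_⟩
  induction hz with
  | base hb =>
    refine ⟨G _, fun s hs => le_max_of_le_right (hn ?_), (hGU _).symm⟩
    exact ⟨s, Set.mem_biUnion hb hs, rfl⟩
  | ldiv hw _ ih =>
    obtain ⟨G', hG', h⟩ := ih
    obtain ⟨w, rfl⟩ := exists_lift_eq hw
    obtain ⟨H, hH, h'⟩ := FreeMagma.exists_upSet_mul_left (le_max_left 1 n) hG' w
    refine ⟨H, hH, ?_⟩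
    rw [← h', ← h]
    ext t
    simp only [Set.mem_ofPred_eq, map_mul, mul_le_iff_le_ldiv]
  | rdiv hw _ ih =>
    obtain ⟨G', hG', h⟩ := ih
    obtain ⟨w, rfl⟩ := exists_lift_eq hw
    obtain ⟨H, hH, h'⟩ := FreeMagma.exists_upSet_mul_right (le_max_left 1 n) hG' w
    refine ⟨H, hH, ?_⟩
    rw [← h', ← h]
    ext t
    simp only [Set.mem_ofPred_eq, map_mul, mul_le_iff_le_rdiv]

theorem finite_galoisAlgebra (hi : Integral A) {B : Set A} (hB : B.Finite) :
    Finite (GaloisAlgebra B) := by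
  have : Finite ↥(insert 1 B : Set A) := hB.insert 1
  obtain ⟨n, hn⟩ := exists_upSet_of_isBound hi hB
  apply Concept.finite_of_finite_lowerPolar
  refine (((FreeMagma.finite_length_le (α := ↥(insert 1 B)) n).finite_subsets.image FreeMagma.upSet).image
    fun U => {w : Submonoid.closure B | ∃ t ∈ U, FreeMagma.lift Subtype.val t = (w : A)}).subset ?_
  rintro _ ⟨z, rfl⟩
  obtain ⟨G, hG, h⟩ := hn z z.2
  refine ⟨_, ⟨G, hG, rfl⟩, ?_⟩
  rw [← h]
  ext w
  constructor
  · rintro ⟨t, ht, hw⟩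
    exact hw.symm.trans_le ht
  · intro hw
    obtain ⟨t, ht⟩ := exists_lift_eq w.2
    exact ⟨t, ht.trans_le hw, ht⟩

/-! ### Operations on the Galois algebra -/

namespace GaloisAlgebra

open Concept Pointwise

variable {B : Set A}

theorem mem_ofObjects {S : Set (Submonoid.closure B)} {w : Submonoid.closure B} :
    w ∈ (ofObjects (boundRel B) S).extent ↔
      ∀ z : A, IsBound B z → (∀ s ∈ S, (s : A) ≤ z) → (w : A) ≤ z :=
  ⟨fun h z hz hS => h (b := ⟨z, hz⟩) fun s hs => hS s hs,
    fun h z hz => h z z.2 fun _ hs => hz hs⟩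

theorem mem_extent {X : GaloisAlgebra B} {w : Submonoid.closure B} :
    w ∈ X.extent ↔ ∀ z : A, IsBound B z → (∀ s ∈ X.extent, (s : A) ≤ z) → (w : A) ≤ z := by
  rw [← mem_ofObjects, ofObjects_extent]

theorem mem_extent_of_le {X : GaloisAlgebra B} {v w : Submonoid.closure B} (h : (v : A) ≤ w)
    (hw : w ∈ X.extent) : v ∈ X.extent :=
  mem_extent.2 fun _ _ hs => h.trans (hs w hw)

theorem subset_ofObjects (S : Set (Submonoid.closure B)) :
    S ⊆ (ofObjects (boundRel B) S).extent :=
  ofObjects_le_iff.1 le_rfl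

/-- The left residual of two concepts. -/
def lres (X Y : GaloisAlgebra B) : GaloisAlgebra B :=
  ofObjects _ {w | ∀ x ∈ X.extent, x * w ∈ Y.extent}

/-- The right residual of two concepts. -/
def rres (Y X : GaloisAlgebra B) : GaloisAlgebra B :=
  ofObjects _ {w | ∀ x ∈ X.extent, w * x ∈ Y.extent}

/-- The defining set is already closed: `x * w ≤ z` means `w ≤ ldiv x z`, and `ldiv x z` is again a
bound. -/
theorem mem_lres {X Y : GaloisAlgebra B} {w : Submonoid.closure B} :
    w ∈ (lres X Y).extent ↔ ∀ x ∈ X.extent, x * w ∈ Y.extent := by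
  refine ⟨fun h x hx => mem_extent.2 fun z hz hY => ?_, fun h => subset_ofObjects _ h⟩
  refine (mul_le_iff_le_ldiv _ _ _).2 (mem_ofObjects.1 h _ (.ldiv x.2 hz) fun s hs => ?_)
  exact (mul_le_iff_le_ldiv _ _ _).1 (hY _ (hs x hx))

theorem mem_rres {X Y : GaloisAlgebra B} {w : Submonoid.closure B} :
    w ∈ (rres Y X).extent ↔ ∀ x ∈ X.extent, w * x ∈ Y.extent := by
  refine ⟨fun h x hx => mem_extent.2 fun z hz hY => ?_, fun h => subset_ofObjects _ h⟩
  refine (mul_le_iff_le_rdiv _ _ _).2 (mem_ofObjects.1 h _ (.rdiv x.2 hz) fun s hs => ?_)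
  exact (mul_le_iff_le_rdiv _ _ _).1 (hY _ (hs x hx))

theorem ofObjects_mul_le_iff_left {X Y Z : GaloisAlgebra B} :
    ofObjects _ (X.extent * Y.extent) ≤ Z ↔ Y ≤ lres X Z := by
  rw [ofObjects_le_iff, Set.mul_subset_iff]
  exact ⟨fun h y hy => mem_lres.2 fun x hx => h x hx y hy,
    fun h x hx y hy => mem_lres.1 (h hy) x hx⟩

theorem ofObjects_mul_le_iff_right {X Y Z : GaloisAlgebra B} :
    ofObjects _ (X.extent * Y.extent) ≤ Z ↔ X ≤ rres Z Y := by
  rw [ofObjects_le_iff, Set.mul_subset_iff]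
  exact ⟨fun h x hx => mem_rres.2 fun y hy => h x hx y hy,
    fun h x hx y hy => mem_rres.1 (h hx) y hy⟩

/-- The nucleus property: residuation allows each factor to be replaced by its generators. Laws for
products of sets thereby pass to concepts. -/
theorem ofObjects_extent_mul_extent (S T : Set (Submonoid.closure B)) :
    ofObjects (boundRel B) ((ofObjects (boundRel B) S).extent * (ofObjects (boundRel B) T).extent) =
      ofObjects (boundRel B) (S * T) := by
  refine le_antisymm ?_
    (ofObjects_le_iff.2 ((Set.mul_subset_mul (subset_ofObjects S) (subset_ofObjects T)).trans
      (subset_ofObjects _)))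
  rw [ofObjects_mul_le_iff_left, ofObjects_le_iff]
  intro t ht
  rw [mem_lres]
  suffices h : ofObjects (boundRel B) S ≤ rres (ofObjects _ (S * T)) (ofObjects _ {t}) from
    fun x hx => mem_rres.1 (h hx) t (subset_ofObjects _ rfl)
  rw [ofObjects_le_iff]
  intro s hs
  rw [mem_rres]
  suffices h : ofObjects (boundRel B) {t} ≤ lres (ofObjects _ {s}) (ofObjects _ (S * T)) from
    fun x hx => mem_lres.1 (h hx) s (subset_ofObjects _ rfl)
  rw [ofObjects_le_iff, Set.singleton_subset_iff, mem_lres]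
  intro x hx
  refine mem_ofObjects.2 fun z hz h => ?_
  refine (mul_le_iff_le_rdiv _ _ _).2 (mem_ofObjects.1 hx _ (.rdiv t.2 hz) ?_)
  rintro _ rfl
  exact (mul_le_iff_le_rdiv _ _ _).1 (h _ (Set.mul_mem_mul hs ht))

variable (B) in
/-- The fixed points of `!` in the unital subgroupoid generated by `B`. -/
def fixed : Set (Submonoid.closure B) := {w | bang (w : A) = w}

theorem mul_subset_fixed : fixed B * fixed B ⊆ fixed B :=
  Set.mul_subset_iff.2 fun _ hx _ hy => bang_mul_of_fixed hx hy

instance : RLUGroupoid (GaloisAlgebra B) where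
  toLattice := inferInstance
  mul X Y := ofObjects _ (X.extent * Y.extent)
  one := ofObjects _ {1}
  one_mul X := by
    change ofObjects _ ((ofObjects _ {1}).extent * X.extent) = X
    conv_lhs => rw [← ofObjects_extent (c := X)]
    rw [ofObjects_extent_mul_extent, Set.singleton_one, one_mul, ofObjects_extent]
  mul_one X := by
    change ofObjects _ (X.extent * (ofObjects _ {1}).extent) = X
    conv_lhs => rw [← ofObjects_extent (c := X)]
    rw [ofObjects_extent_mul_extent, Set.singleton_one, mul_one, ofObjects_extent]
  ldiv := lres
  rdiv := rres
  mul_le_iff_le_ldiv _ _ _ := ofObjects_mul_le_iff_left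
  mul_le_iff_le_rdiv _ _ _ := ofObjects_mul_le_iff_right

theorem mul_def (X Y : GaloisAlgebra B) : X * Y = ofObjects _ (X.extent * Y.extent) := rfl

theorem one_def : (1 : GaloisAlgebra B) = ofObjects _ {1} := rfl

theorem ofObjects_mul_ofObjects (S T : Set (Submonoid.closure B)) :
    ofObjects (boundRel B) S * ofObjects (boundRel B) T = ofObjects _ (S * T) :=
  ofObjects_extent_mul_extent S T

/-- The axioms for `!` hold because the fixed points contain 1 and are closed under products. -/
instance : InteriorRLUGroupoid (GaloisAlgebra B) where
  bang X := ofObjects _ (X.extent ∩ fixed B)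
  one_le_bang_one := by
    rw [one_def, ofObjects_le_iff, Set.singleton_subset_iff]
    exact subset_ofObjects _ ⟨subset_ofObjects _ rfl, bang_one⟩
  bang_mul_bang_le X Y := by
    rw [ofObjects_mul_ofObjects, ofObjects_le_iff]
    refine Set.Subset.trans ?_ (subset_ofObjects _)
    refine Set.subset_inter ?_ ((Set.mul_subset_mul Set.inter_subset_right
      Set.inter_subset_right).trans mul_subset_fixed)
    exact (Set.mul_subset_mul Set.inter_subset_left Set.inter_subset_left).trans
      (subset_ofObjects _)
  bang_le X := ofObjects_le_iff.2 Set.inter_subset_left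
  bang_le_bang_bang X := ofObjects_le_iff.2 ((Set.subset_inter (subset_ofObjects _)
    Set.inter_subset_right).trans (subset_ofObjects _))
  bang_mono _ _ h := ofObjects_le_iff.2 ((Set.inter_subset_inter_left _ h).trans
    (subset_ofObjects _))

theorem bang_def (X : GaloisAlgebra B) : bang X = ofObjects _ (X.extent ∩ fixed B) := rfl

/-! ### Transfer of the (in)equations -/

theorem integral (hi : Integral A) : Integral (GaloisAlgebra B) := fun _ w _ =>
  mem_ofObjects.2 fun _ _ h => (hi w).trans (h 1 rfl)

/-- Inequalities are checked on elements, as extents are down-closed. For equations, `bang X` is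
generated by elements `k` with `bang k = k`, so the law of `A` applies to products of generating
sets. -/
theorem holds {q : Eqn} (hq : q.Holds A) : q.Holds (GaloisAlgebra B) := by
  cases q with
  | e =>
    intro X Y
    rw [mul_def, ofObjects_le_iff, Set.mul_subset_iff]
    exact fun x hx y hy => mem_extent_of_le (hq x y) (subset_ofObjects _ (Set.mul_mem_mul hy hx))
  | c =>
    exact fun X x hx => mem_extent_of_le (hq x) (subset_ofObjects _ (Set.mul_mem_mul hx hx))
  | bang_e =>
    intro X Y
    obtain ⟨T, rfl⟩ := surjective_ofObjects Y
    have h : X.extent ∩ fixed B * T = T * (X.extent ∩ fixed B) := by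
      have hcomm : ∀ k ∈ fixed B, ∀ y : Submonoid.closure B, k * y = y * k := fun k hk y =>
        Subtype.ext (by simpa only [Submonoid.coe_mul, show bang (k : A) = k from hk] using hq k y)
      refine Set.Subset.antisymm (Set.mul_subset_iff.2 fun k hk y hy => ?_)
        (Set.mul_subset_iff.2 fun y hy k hk => ?_)
      · exact hcomm k hk.2 y ▸ Set.mul_mem_mul hy hk
      · exact hcomm k hk.2 y ▸ Set.mul_mem_mul hk hy
    rw [bang_def, ofObjects_mul_ofObjects, ofObjects_mul_ofObjects, h]
  | bang_c =>
    intro X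
    rw [bang_def, ofObjects_le_iff]
    intro k hk
    have hkk : (k : A) ≤ k * k := by
      simpa only [show bang (k : A) = k from hk.2] using hq k
    exact mem_extent_of_le (w := k * k) hkk
      (subset_ofObjects _ (Set.mul_mem_mul (subset_ofObjects _ hk) (subset_ofObjects _ hk)))
  | bang_a1 =>
    intro X Y Z
    obtain ⟨T, rfl⟩ := surjective_ofObjects Y
    obtain ⟨U, rfl⟩ := surjective_ofObjects Z
    have h : X.extent ∩ fixed B * (T * U) = X.extent ∩ fixed B * T * U := by
      have hassoc : ∀ k ∈ fixed B, ∀ y z : Submonoid.closure B, k * (y * z) = k * y * z :=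
        fun k hk y z => Subtype.ext (by
          simpa only [Submonoid.coe_mul, show bang (k : A) = k from hk] using hq k y z)
      ext w
      simp only [Set.mem_mul]
      constructor
      · rintro ⟨k, hk, _, ⟨y, hy, z, hz, rfl⟩, rfl⟩
        exact ⟨_, ⟨k, hk, y, hy, rfl⟩, z, hz, (hassoc k hk.2 y z).symm⟩
      · rintro ⟨_, ⟨k, hk, y, hy, rfl⟩, z, hz, rfl⟩
        exact ⟨k, hk, _, ⟨y, hy, z, hz, rfl⟩, hassoc k hk.2 y z⟩
    simp only [bang_def, ofObjects_mul_ofObjects, h]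
  | bang_a2 =>
    intro X Y Z
    obtain ⟨S, rfl⟩ := surjective_ofObjects X
    obtain ⟨T, rfl⟩ := surjective_ofObjects Y
    have h : S * (T * (Z.extent ∩ fixed B)) = S * T * (Z.extent ∩ fixed B) := by
      have hassoc : ∀ k ∈ fixed B, ∀ x y : Submonoid.closure B, x * (y * k) = x * y * k :=
        fun k hk x y => Subtype.ext (by
          simpa only [Submonoid.coe_mul, show bang (k : A) = k from hk] using hq x y k)
      ext w
      simp only [Set.mem_mul]
      constructor
      · rintro ⟨x, hx, _, ⟨y, hy, k, hk, rfl⟩, rfl⟩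
        exact ⟨_, ⟨x, hx, y, hy, rfl⟩, k, hk, (hassoc k hk.2 x y).symm⟩
      · rintro ⟨_, ⟨x, hx, y, hy, rfl⟩, k, hk, rfl⟩
        exact ⟨x, hx, _, ⟨y, hy, k, hk, rfl⟩, hassoc k hk.2 x y⟩
    simp only [bang_def, ofObjects_mul_ofObjects, h]

/-! ### The embedding of B -/

/-- The image of a member of `B` in the Galois algebra: the elements below it. -/
def principal (b : B) : GaloisAlgebra B := ofAttribute _ ⟨b, .base b.2⟩

theorem mem_principal {b : B} {w : Submonoid.closure B} :
    w ∈ (principal b).extent ↔ (w : A) ≤ b := by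
  simp [principal, boundRel]

/-- The inclusion of `B` into the subgroupoid that it generates. -/
def incl (b : B) : Submonoid.closure B := ⟨b, Submonoid.subset_closure b.2⟩

theorem incl_mem_principal (b : B) : incl b ∈ (principal b).extent :=
  mem_principal.2 le_rfl

/-- Extents are down-closed, so a greatest element determines them. -/
theorem eq_principal {X : GaloisAlgebra B} {b : B} (hb : incl b ∈ X.extent)
    (h : ∀ w ∈ X.extent, (w : A) ≤ b) : X = principal b :=
  le_antisymm (fun w hw => mem_principal.2 (h w hw))
    fun _ hw => mem_extent_of_le (mem_principal.1 hw) hb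

theorem ofObjects_eq_principal {S : Set (Submonoid.closure B)} {b : B} (hb : incl b ∈ S)
    (h : ∀ w ∈ S, (w : A) ≤ b) : ofObjects _ S = principal b :=
  eq_principal (subset_ofObjects _ hb) fun _ hw => mem_ofObjects.1 hw _ (.base b.2) h

theorem principal_injective : Function.Injective (principal (B := B)) := fun a b h =>
  Subtype.ext (le_antisymm (mem_principal.1 (h ▸ incl_mem_principal a))
    (mem_principal.1 (h ▸ incl_mem_principal b)))

theorem principal_inf {a b c : B} (h : (a : A) ⊓ b = c) :
    principal a ⊓ principal b = principal c := by
  ext w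
  simp [mem_principal, ← h]

theorem principal_sup {a b c : B} (h : (a : A) ⊔ b = c) :
    principal a ⊔ principal b = principal c := by
  refine eq_principal (mem_extent.2 fun z _ hz => ?_) ?_
  · refine h.symm.trans_le (sup_le ?_ ?_)
    · exact hz _ ((le_sup_left : principal a ≤ _) (incl_mem_principal a))
    · exact hz _ ((le_sup_right : principal b ≤ _) (incl_mem_principal b))
  · have hle : principal a ⊔ principal b ≤ principal c :=
      sup_le (fun w hw => mem_principal.2 ((mem_principal.1 hw).trans (h ▸ le_sup_left)))
        (fun w hw => mem_principal.2 ((mem_principal.1 hw).trans (h ▸ le_sup_right)))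
    exact fun w hw => mem_principal.1 (hle hw)

theorem principal_mul {a b c : B} (h : (a : A) * b = c) :
    principal a * principal b = principal c := by
  refine ofObjects_eq_principal
    ⟨_, incl_mem_principal a, _, incl_mem_principal b, Subtype.ext h⟩ ?_
  rintro _ ⟨v, hv, w, hw, rfl⟩
  exact (mul_le_mul (mem_principal.1 hv) (mem_principal.1 hw)).trans_eq h

theorem ldiv_principal {a b c : B} (h : ldiv (a : A) b = c) :
    ldiv (principal a) (principal b) = principal c := by
  refine ofObjects_eq_principal (fun x hx => ?_) fun w hw => ?_
  · exact mem_principal.2 ((mul_le_mul (mem_principal.1 hx) le_rfl).trans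
      ((mul_le_iff_le_ldiv _ _ _).2 h.ge))
  · exact ((mul_le_iff_le_ldiv _ _ _).1
      (mem_principal.1 (hw _ (incl_mem_principal a)))).trans_eq h

theorem rdiv_principal {a b c : B} (h : rdiv (a : A) b = c) :
    rdiv (principal a) (principal b) = principal c := by
  refine ofObjects_eq_principal (fun x hx => ?_) fun w hw => ?_
  · exact mem_principal.2 ((mul_le_mul le_rfl (mem_principal.1 hx)).trans
      ((mul_le_iff_le_rdiv _ _ _).2 h.ge))
  · exact ((mul_le_iff_le_rdiv _ _ _).1
      (mem_principal.1 (hw _ (incl_mem_principal b)))).trans_eq h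

theorem bang_principal {a c : B} (h : bang (a : A) = c) :
    bang (principal a) = principal c := by
  -- By idempotence and monotonicity of `!`, `c` is the greatest fixed point below `a`.
  refine ofObjects_eq_principal ⟨mem_principal.2 (h.symm.trans_le (bang_le _)), ?_⟩ fun w hw => ?_
  · change bang (c : A) = c
    rw [← h, bang_bang]
  · rw [← h, ← show bang (w : A) = w from hw.2]
    exact bang_mono _ _ (mem_principal.1 hw.1)

theorem one_eq_principal {c : B} (h : 1 = (c : A)) : 1 = principal c :=
  ofObjects_eq_principal (Subtype.ext h.symm) (by rintro _ rfl; exact h.le)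

theorem isEmbedding_principal :
    @IsEmbedding lang (@partialSubalgebra lang A (toAlgebra A) B) (GaloisAlgebra B)
      (toAlgebra (GaloisAlgebra B)) principal :=
  letI := toAlgebra A
  letI := toAlgebra (GaloisAlgebra B)
  { injective := principal_injective
    map_op := fun {n} f x h => by
      symm
      cases (f : OpSymbol n) with
      | inf => exact principal_inf rfl
      | sup => exact principal_sup rfl
      | mul => exact principal_mul rfl
      | ldiv => exact ldiv_principal rfl
      | rdiv => exact rdiv_principal rfl
      | bang => exact bang_principal rfl
      | one => exact one_eq_principal rfl }

end GaloisAlgebra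

end Interior

end RLU

theorem mainTheorem4 (R : Set RLU.Eqn) : RLU.HasFEP (RLU.variety.{u} R) := by
  rintro ⟨A, str⟩ ⟨inst, hstr, hi, hR⟩ B hB
  change RLU.InteriorRLUGroupoid A at inst
  change str = RLU.toAlgebra A at hstr
  subst hstr
  exact ⟨⟨RLU.GaloisAlgebra B, RLU.toAlgebra _⟩,
    ⟨inferInstance, rfl, RLU.GaloisAlgebra.integral hi, fun q hq =>
      RLU.GaloisAlgebra.holds (hR q hq)⟩,
    RLU.finite_galoisAlgebra hi hB, RLU.GaloisAlgebra.principal,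
    RLU.GaloisAlgebra.isEmbedding_principal⟩
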